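/- Let $C$ be a nonzero coalgebra over a field $k$ with comultiplication $\Delta$, and let $C^*=\mathrm{Hom}_k(C,k)$ be its dual algebra, with the convolution product $(f*g)(c)=\sum f(c_1)g(c_2)$, where $\Delta(c)=\sum c_1\otimes c_2$, and with the counit as its unit. A right $C$-comodule $M$ with coaction $m\mapsto\sum m_0\otimes m_1$ is a left $C^*$-module via $f\rightharpoonup m=\sum f(m_1)\,m_0$; symmetrically, a left $C$-comodule with coaction $m\mapsto\sum m_{-1}\otimes m_0$ is a right $C^*$-module via $m\leftharpoonup f=\sum f(m_{-1})\,m_0$. Regard $C$ as a right and as a left comodule over itself through $\Delta$. For a right (respectively left) $C$-comodule $M$, let $\mathrm{Ann}$ denote annihilators in $C^*$ with respect to this module structure. The comodule $M$ is called *coprime* if $\mathrm{Ann}(M/K)=\mathrm{Ann}(M)$ for every proper $C^*$-submodule $K$ of $M$ (it is equivalent to require this only for those $K$ that are mapped into themselves by all $C^*$-endomorphisms of $M$). A right $C$-comodule $M$ is called *fully coprime* if for every proper $C^*$-submodule $K$ of $M$ that is mapped into itself by all $C^*$-endomorphisms of $M$, the $C^*$-module $M$ is an epimorphic image of a direct sum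 of copies of $M/K$. A right $C$-comodule $M$ is called *endo-coprime* if for every proper subcomodule $K$ of $M$ that is mapped into itself by all comodule endomorphisms of $M$, the only comodule endomorphism $f$ of $M$ with $f(M)\subseteq K$ is $f=0$. A ring $A$ is called *prime* if $A\ne 0$ and, for all two-sided ideals $I,J$ of $A$, $IJ=0$ implies $I=0$ or $J=0$. Then the following statements are equivalent: (a) $C$ is coprime as a right $C$-comodule. (b) $C$ is coprime as a left $C$-comodule. (c) $C$ is endo-coprime as a right $C$-comodule. (d) $C$ is fully coprime as a right $C$-comodule. (e) For every left ideal $I$ of $C^*$, the subspace $I\rightharpoonup C$ spanned by all $f\rightharpoonup c$ with $f\in I$ and $c\in C$ is either $0$ or $C$. (f) $C^*$ is a prime algebra. -/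

import Mathlib

open scoped TensorProduct

universe u v w

/-! ### Modules over a (not necessarily commutative) ring -/

section Modules

variable (R : Type u) [Ring R] (M : Type v) [AddCommGroup M] [Module R M]

/-- `M` is *coprime*: every proper submodule `K` satisfies `Ann_R(M/K) = Ann_R(M)`. -/
def IsCoprimeModule : Prop :=
  ∀ K : Submodule R M, K ≠ ⊤ → Module.annihilator R (M ⧸ K) = Module.annihilator R M

/-- In the definition of a coprime module it does not matter whether `K` ranges over all
proper submodules or only over the fully invariant ones. -/
theorem isCoprimeModule_iff_fullyInvariant :
    IsCoprimeModule R M ↔ ∀ K : Submodule R M, K.IsFullyInvariant → K ≠ ⊤ →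
      Module.annihilator R (M ⧸ K) = Module.annihilator R M := by
  refine ⟨fun h K _ hK => h K hK, fun h K hK => le_antisymm ?_ ?_⟩
  · intro r hr
    let L : Submodule R M := Module.annihilator R (M ⧸ K) • ⊤
    have hLK : L ≤ K := by
      refine Submodule.smul_le.2 fun s hs m _ => ?_
      have := Module.mem_annihilator.1 hs (K.mkQ m)
      rwa [← map_smul, Submodule.mkQ_apply, Submodule.Quotient.mk_eq_zero] at this
    have hL : L.IsFullyInvariant := by
      intro f
      refine Submodule.smul_le.2 fun s hs m _ => ?_
      rw [Submodule.mem_comap, map_smul]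
      exact Submodule.smul_mem_smul hs trivial
    rw [← h L hL fun e => hK (top_le_iff.1 (e ▸ hLK))]
    refine Module.mem_annihilator.2 fun q => ?_
    obtain ⟨m, rfl⟩ := L.mkQ_surjective q
    rw [← map_smul, Submodule.mkQ_apply, Submodule.Quotient.mk_eq_zero]
    exact Submodule.smul_mem_smul hr trivial
  · exact LinearMap.annihilator_le_of_surjective K.mkQ K.mkQ_surjective

/-- `M` is *`N`-generated*: it is an epimorphic image of a direct sum of copies of `N`. -/
def IsGeneratedByModule (N : Type w) [AddCommGroup N] [Module R N] : Prop :=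
  ∃ (ι : Type (max v w)) (f : (ι →₀ N) →ₗ[R] M), Function.Surjective f

/-- `M` is *fully coprime*: for every proper fully invariant submodule `K`, the module `M` is
`M/K`-generated. -/
def IsFullyCoprimeModule : Prop :=
  ∀ K : Submodule R M, K.IsFullyInvariant → K ≠ ⊤ → IsGeneratedByModule R M (M ⧸ K)

/-- A ring is *prime* if it is nonzero and the product of two nonzero two-sided ideals is
nonzero. -/
def IsPrimeAlgebra : Prop :=
  Nontrivial R ∧ ∀ I J : Ideal R, I.IsTwoSided → J.IsTwoSided → I * J = ⊥ → I = ⊥ ∨ J = ⊥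

end Modules

/-! ### The dual algebra and comodules -/

section Comodules

/-- The dual algebra `C* = Hom_k(C, k)` of a coalgebra, with the convolution product
`(f * g)(c) = ∑ f(c₁) g(c₂)` and unit the counit. -/
abbrev DualAlgebra (k : Type u) (C : Type v) [Field k] [AddCommGroup C] [Module k C] : Type _ :=
  WithConv (C →ₗ[k] k)

/-- A right `C`-comodule structure on `M`. -/
class RightComodule (k : Type u) (C : Type v) (M : Type w) [Field k] [AddCommGroup C] [Module k C]
    [Coalgebra k C] [AddCommGroup M] [Module k M] where
  /-- The coaction `ϱ : M → M ⊗ C`. -/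
  coact : M →ₗ[k] M ⊗[k] C
  coassoc : TensorProduct.assoc k M C C ∘ₗ coact.rTensor C ∘ₗ coact
    = (Coalgebra.comul (R := k) (A := C)).lTensor M ∘ₗ coact
  counit_coact : TensorProduct.rid k M ∘ₗ (Coalgebra.counit (R := k) (A := C)).lTensor M ∘ₗ coact
    = LinearMap.id

/-- A left `C`-comodule structure on `M`. -/
class LeftComodule (k : Type u) (C : Type v) (M : Type w) [Field k] [AddCommGroup C] [Module k C]
    [Coalgebra k C] [AddCommGroup M] [Module k M] where
  /-- The coaction `ϱ : M → C ⊗ M`. -/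
  coact : M →ₗ[k] C ⊗[k] M
  coassoc : TensorProduct.assoc k C C M ∘ₗ (Coalgebra.comul (R := k) (A := C)).rTensor M ∘ₗ coact
    = coact.lTensor C ∘ₗ coact
  counit_coact : TensorProduct.lid k M ∘ₗ (Coalgebra.counit (R := k) (A := C)).rTensor M ∘ₗ coact
    = LinearMap.id

variable (k : Type u) (C : Type v) [Field k] [AddCommGroup C] [Module k C] [Coalgebra k C]

/-- `C` as a right comodule over itself. -/
instance RightComodule.regular : RightComodule k C C where
  coact := Coalgebra.comul
  coassoc := Coalgebra.coassoc
  counit_coact := by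
    rw [Coalgebra.lTensor_counit_comp_comul]
    ext; simp

/-- `C` as a left comodule over itself. -/
instance LeftComodule.regular : LeftComodule k C C where
  coact := Coalgebra.comul
  coassoc := Coalgebra.coassoc
  counit_coact := by
    rw [Coalgebra.rTensor_counit_comp_comul]
    ext; simp

variable (M : Type w) [AddCommGroup M] [Module k M]

/-- The action `f ⇀ m = (id ⊗ f)(ϱ m) = ∑ f(m₁) m₀` of `f ∈ C*` on a right comodule. -/
noncomputable def RightComodule.act [RightComodule k C M] (f : DualAlgebra k C) : M →ₗ[k] M :=
  TensorProduct.rid k M ∘ₗ f.ofConv.lTensor M ∘ₗ RightComodule.coact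

/-- The action `m ↼ f = (f ⊗ id)(ϱ m) = ∑ f(m₋₁) m₀` of `f ∈ C*` on a left comodule. -/
noncomputable def LeftComodule.act [LeftComodule k C M] (f : DualAlgebra k C) : M →ₗ[k] M :=
  TensorProduct.lid k M ∘ₗ f.ofConv.rTensor M ∘ₗ LeftComodule.coact

theorem RightComodule.act_mul [RightComodule k C M] (f g : DualAlgebra k C) :
    RightComodule.act k C M (f * g) = RightComodule.act k C M f ∘ₗ RightComodule.act k C M g := by
  have key : ∀ (s : M ⊗[k] C) (c : C),
      TensorProduct.rid k M ((LinearMap.mul' k k ∘ₗ TensorProduct.map f.ofConv g.ofConv).lTensor M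
        (TensorProduct.assoc k M C C (s ⊗ₜ[k] c)))
      = g.ofConv c • TensorProduct.rid k M (f.ofConv.lTensor M s) := by
    intro s c
    induction s with
    | zero => simp
    | tmul m d => simp [smul_smul, mul_comm]
    | add x y hx hy => simp only [TensorProduct.add_tmul, map_add, hx, hy, smul_add]
  have key2 : ∀ t : M ⊗[k] C,
      TensorProduct.rid k M ((LinearMap.mul' k k ∘ₗ TensorProduct.map f.ofConv g.ofConv).lTensor M
        (TensorProduct.assoc k M C C ((RightComodule.coact (M := M)).rTensor C t)))
      = RightComodule.act k C M f (TensorProduct.rid k M (g.ofConv.lTensor M t)) := by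
    intro t
    induction t with
    | zero => simp
    | tmul m c => simp [key, RightComodule.act]
    | add x y hx hy => simp only [map_add, hx, hy]
  ext m
  have h := key2 (RightComodule.coact m)
  have h2 := DFunLike.congr_fun (RightComodule.coassoc (k := k) (C := C) (M := M)) m
  simp only [LinearMap.comp_apply, LinearEquiv.coe_coe] at h2
  rw [h2, ← LinearMap.comp_apply, ← LinearMap.lTensor_comp, LinearMap.comp_assoc] at h
  exact h

theorem LeftComodule.act_mul [LeftComodule k C M] (f g : DualAlgebra k C) :
    LeftComodule.act k C M (f * g) = LeftComodule.act k C M g ∘ₗ LeftComodule.act k C M f := by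
  have key : ∀ (s : C ⊗[k] M) (c : C),
      TensorProduct.lid k M ((LinearMap.mul' k k ∘ₗ TensorProduct.map f.ofConv g.ofConv).rTensor M
        ((TensorProduct.assoc k C C M).symm (c ⊗ₜ[k] s)))
      = f.ofConv c • TensorProduct.lid k M (g.ofConv.rTensor M s) := by
    intro s c
    induction s with
    | zero => simp
    | tmul d m => simp [smul_smul]
    | add x y hx hy => simp only [TensorProduct.tmul_add, map_add, hx, hy, smul_add]
  have key2 : ∀ t : C ⊗[k] M,
      TensorProduct.lid k M ((LinearMap.mul' k k ∘ₗ TensorProduct.map f.ofConv g.ofConv).rTensor M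
        ((TensorProduct.assoc k C C M).symm ((LeftComodule.coact (M := M)).lTensor C t)))
      = LeftComodule.act k C M g (TensorProduct.lid k M (f.ofConv.rTensor M t)) := by
    intro t
    induction t with
    | zero => simp
    | tmul c m => simp [key, LeftComodule.act]
    | add x y hx hy => simp only [map_add, hx, hy]
  ext m
  have h := key2 (LeftComodule.coact m)
  have h2 := DFunLike.congr_fun (LeftComodule.coassoc (k := k) (C := C) (M := M)) m
  simp only [LinearMap.comp_apply, LinearEquiv.coe_coe] at h2
  rw [← h2, LinearEquiv.symm_apply_apply, ← LinearMap.comp_apply, ← LinearMap.rTensor_comp,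
    LinearMap.comp_assoc] at h
  exact h

/-- A right `C`-comodule is a left `C*`-module via `⇀`. -/
noncomputable instance RightComodule.dualModule [RightComodule k C M] :
    Module (DualAlgebra k C) M where
  smul f m := RightComodule.act k C M f m
  one_smul m := DFunLike.congr_fun (RightComodule.counit_coact (k := k) (C := C) (M := M)) m
  mul_smul f g m := DFunLike.congr_fun (RightComodule.act_mul k C M f g) m
  smul_zero f := map_zero _
  smul_add f := map_add _
  add_smul f g m := by
    change RightComodule.act k C M (f + g) m = _ + _
    simp only [RightComodule.act, WithConv.ofConv_add, LinearMap.lTensor_add,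
      LinearMap.add_comp, LinearMap.comp_add, LinearMap.add_apply]
    rfl
  zero_smul m := by
    change RightComodule.act k C M 0 m = 0
    simp [RightComodule.act]

/-- A left `C`-comodule is a right `C*`-module, i.e. a left module over the opposite ring of `C*`,
via `↼`. -/
noncomputable instance LeftComodule.dualModule [LeftComodule k C M] :
    Module (DualAlgebra k C)ᵐᵒᵖ M where
  smul f m := LeftComodule.act k C M f.unop m
  one_smul m := DFunLike.congr_fun (LeftComodule.counit_coact (k := k) (C := C) (M := M)) m
  mul_smul f g m := DFunLike.congr_fun (LeftComodule.act_mul k C M g.unop f.unop) m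
  smul_zero f := map_zero _
  smul_add f := map_add _
  add_smul f g m := by
    change LeftComodule.act k C M (f.unop + g.unop) m = _ + _
    simp only [LeftComodule.act, WithConv.ofConv_add, LinearMap.rTensor_add,
      LinearMap.add_comp, LinearMap.comp_add, LinearMap.add_apply]
    rfl
  zero_smul m := by
    change LeftComodule.act k C M 0 m = 0
    simp [LeftComodule.act]

/-- A right comodule is *coprime* if it is coprime as a left `C*`-module. -/
def RightComodule.IsCoprime [RightComodule k C M] : Prop :=
  IsCoprimeModule (DualAlgebra k C) M

/-- A left comodule is *coprime* if it is coprime as a right `C*`-module. -/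
def LeftComodule.IsCoprime [LeftComodule k C M] : Prop :=
  IsCoprimeModule (DualAlgebra k C)ᵐᵒᵖ M

/-- A right comodule is *fully coprime* if it is fully coprime as a left `C*`-module. -/
def RightComodule.IsFullyCoprime [RightComodule k C M] : Prop :=
  IsFullyCoprimeModule (DualAlgebra k C) M

/-- A subspace `K` of a right comodule `M` is a *subcomodule* if `ϱ(K) ⊆ K ⊗ C`. -/
def RightComodule.IsSubcomodule [RightComodule k C M] (K : Submodule k M) : Prop :=
  ∀ m ∈ K, RightComodule.coact m ∈ LinearMap.range (K.subtype.rTensor C)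

/-- The algebra `End^C(M)` of comodule endomorphisms: linear maps `f` with
`ϱ ∘ f = (f ⊗ id) ∘ ϱ`. -/
def RightComodule.endAlgebra [RightComodule k C M] : Subalgebra k (Module.End k M) where
  carrier := {f | (RightComodule.coact : M →ₗ[k] M ⊗[k] C) ∘ₗ f
    = f.rTensor C ∘ₗ RightComodule.coact}
  mul_mem' {f g} hf hg := by
    simp only [Set.mem_ofPred_eq] at hf hg ⊢
    rw [Module.End.mul_eq_comp, ← LinearMap.comp_assoc, hf, LinearMap.comp_assoc, hg,
      LinearMap.rTensor_comp, LinearMap.comp_assoc]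
  add_mem' {f g} hf hg := by
    simp only [Set.mem_ofPred_eq] at hf hg ⊢
    rw [LinearMap.comp_add, hf, hg, LinearMap.rTensor_add, LinearMap.add_comp]
  algebraMap_mem' r := by
    simp only [Set.mem_ofPred_eq, Module.algebraMap_end_eq_smul_id, LinearMap.comp_smul,
      LinearMap.rTensor_smul, LinearMap.smul_comp, LinearMap.rTensor_id, LinearMap.comp_id,
      LinearMap.id_comp]

/-- A right comodule `M` with `S = End^C(M)` is *endo-coprime* if for every proper fully invariant
subcomodule `K` the annihilator `Ann_S(M/K) = {f ∈ S | f(M) ⊆ K}` is zero. -/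
def RightComodule.IsEndoCoprime [RightComodule k C M] : Prop :=
  ∀ K : Submodule k M, RightComodule.IsSubcomodule k C M K →
    (∀ f ∈ RightComodule.endAlgebra k C M, ∀ m ∈ K, f m ∈ K) → K ≠ ⊤ →
    ∀ f ∈ RightComodule.endAlgebra k C M, (∀ m : M, f m ∈ K) → f = 0

end Comodules

/-!
The proof rests on the pairing of `C*` with `C`. The elements of `C*` separate the points of `C`,
and both actions of `C*` on `C` are transposes of multiplications:
`g (f ⇀ c) = (g * f) c` and `g (c ↼ f) = (f * g) c`
(`DualAlgebra.apply_smul`, `DualAlgebra.apply_op_smul`). Hence identities about the actions can be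
tested against functionals, where they become associativity in `C*`. In this way both actions are
faithful, they commute, and every endomorphism of `C` as a right comodule, or as a left `C*`-module,
is `c ↼ g` for some `g` in `C*`.

Primeness is used elementwise: if `a * r * b = 0` for all `r`, then `a = 0` or `b = 0`.

A faithful coprime module over any ring forces the ring to be prime, and a fully coprime module is
coprime. In the other direction, a proper subspace `K` of `C` is killed by some `h ≠ 0` in `C*`. If
`K` is a left `C*`-submodule and `f ⇀ C ⊆ K`, then `h * r * f = 0` for all `r`, so `f = 0` when `C*`
is prime; the same argument with the sides exchanged gives the left coprimeness and the
endo-coprimeness of `C`. For full coprimeness, each `g` in `C*` that vanishes on a submodule `K`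
gives a map `C/K → C`, `c ↦ c ↼ g`. If a functional `b` vanishes on the images of all these maps,
then `h * r * b = 0` for all `r`, so `b = 0`.

Finally, endo-coprimeness implies primeness: if `a * r * b = 0` for all `r`, the largest subspace
`K` contained in the kernel of `b` and stable under both actions contains `C ↼ a`. It is a
subcomodule since stability under `⇀` suffices for that (`RightComodule.isSubcomodule_of_act_mem`).
-/

/-! ### Prime rings and coprime modules -/

section Modules

variable {R : Type u} [Ring R] {M : Type v} [AddCommGroup M] [Module R M]

/-- The elementwise description of prime rings, which, unlike the definition by ideals, is visibly
symmetric under passing to the opposite ring. -/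
theorem isPrimeAlgebra_iff :
    IsPrimeAlgebra R ↔ Nontrivial R ∧ ∀ a b : R, (∀ r, a * r * b = 0) → a = 0 ∨ b = 0 := by
  refine and_congr_right fun _ => ⟨fun h a b hab => ?_, fun h I J _ _ hIJ => ?_⟩
  · -- `I` is the left annihilator of the left ideal `R b`, and `J` the right annihilator of `I`.
    let I : Ideal R :=
      { carrier := {x | ∀ r, x * r * b = 0}
        add_mem' := fun hx hy r => by rw [add_mul, add_mul, hx, hy, add_zero]
        zero_mem' := fun r => by rw [zero_mul, zero_mul]
        smul_mem' := fun s x hx r => by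
          rw [smul_eq_mul, mul_assoc, mul_assoc, ← mul_assoc x, hx, mul_zero] }
    let J : Ideal R :=
      { carrier := {y | ∀ x ∈ I, x * y = 0}
        add_mem' := fun hx hy z hz => by rw [mul_add, hx z hz, hy z hz, add_zero]
        zero_mem' := fun x _ => mul_zero x
        smul_mem' := fun s y hy x hx => by
          rw [smul_eq_mul, ← mul_assoc]
          exact hy _ fun r => by rw [mul_assoc x]; exact hx _ }
    have hI : I.IsTwoSided := ⟨fun {x} s hx r => by rw [mul_assoc x]; exact hx _⟩
    have hJ : J.IsTwoSided := ⟨fun {y} s hy x hx => by rw [← mul_assoc, hy x hx, zero_mul]⟩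
    have hIJ : I * J = ⊥ := le_bot_iff.1 <| Ideal.mul_le.2 fun x hx y hy => hy x hx
    have haI : a ∈ I := hab
    have hbJ : b ∈ J := fun x hx => by simpa using hx 1
    refine (h I J hI hJ hIJ).imp (fun e => ?_) fun e => ?_
    · rwa [e] at haI
    · rwa [e] at hbJ
  · by_contra! hne
    obtain ⟨a, ha, ha0⟩ := Submodule.exists_mem_ne_zero_of_ne_bot hne.1
    obtain ⟨b, hb, hb0⟩ := Submodule.exists_mem_ne_zero_of_ne_bot hne.2
    refine (h a b fun r => ?_).elim ha0 hb0
    have : a * (r * b) ∈ I * J := Ideal.mul_mem_mul ha (J.mul_mem_left r hb)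
    rwa [hIJ, Submodule.mem_bot, ← mul_assoc] at this

theorem IsPrimeAlgebra.of_mulOpposite (h : IsPrimeAlgebra Rᵐᵒᵖ) : IsPrimeAlgebra R := by
  obtain ⟨_, h⟩ := isPrimeAlgebra_iff.1 h
  refine isPrimeAlgebra_iff.2 ⟨MulOpposite.unop_injective.nontrivial, fun a b hab => ?_⟩
  refine (h (.op b) (.op a) fun r => ?_).symm.imp (MulOpposite.op_eq_zero_iff a).1
    (MulOpposite.op_eq_zero_iff b).1
  refine MulOpposite.unop_injective ?_
  simpa [mul_assoc] using hab r.unop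

/-- `M` is coprime iff `I M` is `0` or `M` for every left ideal `I`. -/
theorem isCoprimeModule_iff_smul_top :
    IsCoprimeModule R M ↔
      ∀ I : Ideal R, I • (⊤ : Submodule R M) = ⊥ ∨ I • (⊤ : Submodule R M) = ⊤ := by
  constructor
  · intro h I
    refine or_iff_not_imp_right.2 fun hI => le_bot_iff.1 <| Submodule.smul_le.2 fun f hf m _ => ?_
    refine Module.mem_annihilator.1 (h _ hI ▸ Module.mem_annihilator.2 fun q => ?_) m
    obtain ⟨m, rfl⟩ := Submodule.mkQ_surjective _ q
    rw [← map_smul, Submodule.mkQ_apply, Submodule.Quotient.mk_eq_zero]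
    exact Submodule.smul_mem_smul hf trivial
  · intro h K hK
    refine le_antisymm (fun f hf => Module.mem_annihilator.2 fun m => ?_)
      (LinearMap.annihilator_le_of_surjective K.mkQ K.mkQ_surjective)
    have hle : Module.annihilator R (M ⧸ K) • (⊤ : Submodule R M) ≤ K := by
      refine Submodule.smul_le.2 fun s hs m _ => ?_
      have := Module.mem_annihilator.1 hs (K.mkQ m)
      rwa [← map_smul, Submodule.mkQ_apply, Submodule.Quotient.mk_eq_zero] at this
    have hbot := (h (Module.annihilator R (M ⧸ K))).resolve_right
      fun e => hK (top_le_iff.1 (e ▸ hle))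
    rw [← Submodule.mem_bot R, ← hbot]
    exact Submodule.smul_mem_smul hf trivial

/-- To prove coprimeness it is enough that `f M ⊆ K ≠ M` forces `f = 0`. -/
theorem isCoprimeModule_of_forall_eq_zero
    (h : ∀ K : Submodule R M, K ≠ ⊤ → ∀ f : R, (∀ m : M, f • m ∈ K) → f = 0) :
    IsCoprimeModule R M := by
  refine fun K hK => le_antisymm (fun f hf => ?_)
    (LinearMap.annihilator_le_of_surjective K.mkQ K.mkQ_surjective)
  rw [h K hK f fun m => ?_]
  · exact zero_mem _
  · have := Module.mem_annihilator.1 hf (K.mkQ m)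
    rwa [← map_smul, Submodule.mkQ_apply, Submodule.Quotient.mk_eq_zero] at this

theorem IsCoprimeModule.isPrimeAlgebra [Nontrivial M] [FaithfulSMul R M]
    (h : IsCoprimeModule R M) : IsPrimeAlgebra R := by
  have eq_bot {I : Ideal R} (hI : I • (⊤ : Submodule R M) = ⊥) : I = ⊥ := by
    refine le_bot_iff.1 fun f hf => ?_
    refine eq_of_smul_eq_smul (α := M) fun m => ?_
    rw [zero_smul, ← Submodule.mem_bot R, ← hI]
    exact Submodule.smul_mem_smul hf trivial
  refine ⟨Module.nontrivial R M, fun I J _ _ hIJ => ?_⟩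
  refine (isCoprimeModule_iff_smul_top.1 h J).symm.imp (fun hJ => eq_bot ?_) eq_bot
  rw [← hJ, ← Submodule.mul_smul, hIJ, Submodule.bot_smul]

theorem IsFullyCoprimeModule.isCoprimeModule (h : IsFullyCoprimeModule R M) :
    IsCoprimeModule R M := by
  refine (isCoprimeModule_iff_fullyInvariant R M).2 fun K hinv hK => le_antisymm ?_
    (LinearMap.annihilator_le_of_surjective K.mkQ K.mkQ_surjective)
  obtain ⟨ι, F, hF⟩ := h K hinv hK
  refine fun f hf => Module.mem_annihilator.2 fun m => ?_
  obtain ⟨x, rfl⟩ := hF m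
  have hx : f • x = 0 := Finsupp.ext fun i => Module.mem_annihilator.1 hf (x i)
  rw [← map_smul, hx, map_zero]

end Modules

/-! ### The pairing of the dual algebra with the coalgebra -/

section Pairing

variable {k : Type u} {C : Type v} [Field k] [AddCommGroup C] [Module k C]

open MulOpposite

namespace DualAlgebra

theorem ext_of_apply {x y : C} (h : ∀ g : DualAlgebra k C, g.ofConv x = g.ofConv y) : x = y := by
  rw [← sub_eq_zero, ← Module.forall_dual_apply_eq_zero_iff k]
  intro φ
  rw [map_sub, sub_eq_zero]
  exact h (WithConv.toConv φ)

/-- A proper subspace of `C` is killed by a nonzero element of `C*`. -/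
theorem exists_ne_zero_forall_mem_eq_zero {K : Submodule k C} (hK : K ≠ ⊤) :
    ∃ h : DualAlgebra k C, h ≠ 0 ∧ ∀ c ∈ K, h.ofConv c = 0 := by
  obtain ⟨φ, hφ, hle⟩ := K.exists_le_ker_of_lt_top hK.lt_top
  exact ⟨WithConv.toConv φ, fun e => hφ (WithConv.toConv_injective e), fun c hc => hle hc⟩

end DualAlgebra

namespace RightComodule

variable {M : Type w} [AddCommGroup M] [Module k M]

/-- The maps `id ⊗ f` with `f` in `C*` separate the points of `M ⊗ C`. -/
theorem tensor_ext {s t : M ⊗[k] C}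
    (h : ∀ f : C →ₗ[k] k, TensorProduct.rid k M (f.lTensor M s)
      = TensorProduct.rid k M (f.lTensor M t)) : s = t := by
  classical
  let b := Module.Basis.ofVectorSpace k C
  refine (TensorProduct.equivFinsuppOfBasisRight b).injective (Finsupp.ext fun i => ?_)
  rw [TensorProduct.equivFinsuppOfBasisRight_apply, TensorProduct.equivFinsuppOfBasisRight_apply, h]

theorem rid_lTensor_rTensor {N : Type*} [AddCommGroup N] [Module k N] (φ : M →ₗ[k] N)
    (f : C →ₗ[k] k) (t : M ⊗[k] C) :
    TensorProduct.rid k N (f.lTensor N (φ.rTensor C t))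
      = φ (TensorProduct.rid k M (f.lTensor M t)) := by
  induction t with
  | zero => simp
  | tmul m c => simp
  | add x y hx hy => simp only [map_add, hx, hy]

end RightComodule

variable [Coalgebra k C]

namespace DualAlgebra

theorem apply_smul (g f : DualAlgebra k C) (c : C) : g.ofConv (f • c) = (g * f).ofConv c := by
  have key (t : C ⊗[k] C) : g.ofConv (TensorProduct.rid k C (f.ofConv.lTensor C t))
      = LinearMap.mul' k k (TensorProduct.map g.ofConv f.ofConv t) := by
    induction t with
    | zero => simp
    | tmul a b => simp [mul_comm]
    | add x y hx hy => simp only [map_add, hx, hy]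
  exact key (Coalgebra.comul c)

theorem apply_op_smul (g f : DualAlgebra k C) (c : C) :
    g.ofConv (op f • c) = (f * g).ofConv c := by
  have key (t : C ⊗[k] C) : g.ofConv (TensorProduct.lid k C (f.ofConv.rTensor C t))
      = LinearMap.mul' k k (TensorProduct.map f.ofConv g.ofConv t) := by
    induction t with
    | zero => simp
    | tmul a b => simp
    | add x y hx hy => simp only [map_add, hx, hy]
  exact key (Coalgebra.comul c)

theorem counit_smul (f : DualAlgebra k C) (c : C) :
    Coalgebra.counit (R := k) (f • c) = f.ofConv c :=
  (apply_smul 1 f c).trans (by rw [one_mul])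

theorem eq_zero_of_smul {f : DualAlgebra k C} (h : ∀ c : C, f • c = 0) : f = 0 := by
  refine WithConv.ext (LinearMap.ext fun c => ?_)
  rw [← counit_smul, h, map_zero]
  rfl

theorem eq_zero_of_op_smul {f : DualAlgebra k C} (h : ∀ c : C, op f • c = 0) : f = 0 := by
  refine WithConv.ext (LinearMap.ext fun c => ?_)
  have := apply_op_smul 1 f c
  rw [h, map_zero, mul_one] at this
  exact this.symm

instance : FaithfulSMul (DualAlgebra k C) C where
  eq_of_smul_eq_smul h := sub_eq_zero.1 <| eq_zero_of_smul fun c => by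
    rw [sub_smul, h, sub_self]

instance : FaithfulSMul (DualAlgebra k C)ᵐᵒᵖ C where
  eq_of_smul_eq_smul {f g} h := unop_injective <| sub_eq_zero.1 <| eq_zero_of_op_smul fun c => by
    rw [op_sub, op_unop, op_unop, sub_smul, h, sub_self]

instance : SMulCommClass (DualAlgebra k C) (DualAlgebra k C)ᵐᵒᵖ C where
  smul_comm f g c := ext_of_apply fun h : DualAlgebra k C => by
    obtain ⟨g, rfl⟩ := op_surjective g
    simp only [apply_smul, apply_op_smul, mul_assoc]

instance : IsScalarTower k (DualAlgebra k C) C where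
  smul_assoc r f c := ext_of_apply fun h : DualAlgebra k C => by
    rw [apply_smul, mul_smul_comm, LinearMap.map_smul_of_tower, apply_smul]
    rfl

instance : IsScalarTower k (DualAlgebra k C)ᵐᵒᵖ C where
  smul_assoc r f c := ext_of_apply fun h : DualAlgebra k C => by
    obtain ⟨f, rfl⟩ := op_surjective f
    rw [← op_smul, apply_op_smul, smul_mul_assoc, LinearMap.map_smul_of_tower, apply_op_smul]
    rfl

/-- A linear endomorphism of `C` that commutes with `⇀` is the action `↼` of its composite with
the counit. -/
theorem op_toConv_counit_comp_smul {f : C →ₗ[k] C}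
    (hf : ∀ (r : DualAlgebra k C) (c : C), f (r • c) = r • f c) (c : C) :
    op (WithConv.toConv (Coalgebra.counit ∘ₗ f) : DualAlgebra k C) • c = f c :=
  ext_of_apply fun h => by
    rw [apply_op_smul, ← apply_smul, WithConv.ofConv_toConv, LinearMap.comp_apply, hf, counit_smul]

end DualAlgebra

/-! ### Subcomodules and comodule endomorphisms -/

namespace RightComodule

variable {M : Type w} [AddCommGroup M] [Module k M] [RightComodule k C M]

/-- Over a field, every `C*`-submodule of a comodule is a subcomodule. -/
theorem isSubcomodule_of_act_mem {K : Submodule k M}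
    (h : ∀ f : DualAlgebra k C, ∀ m ∈ K, f • m ∈ K) : IsSubcomodule k C M K := by
  intro m hm
  rw [← rTensor_mkQ, LinearMap.mem_ker]
  refine tensor_ext fun f => ?_
  rw [rid_lTensor_rTensor, map_zero, map_zero, Submodule.mkQ_apply, Submodule.Quotient.mk_eq_zero]
  exact h (WithConv.toConv f) m hm

/-- Comodule endomorphisms are the same as `C*`-linear endomorphisms. -/
theorem mem_endAlgebra_iff {φ : Module.End k M} :
    φ ∈ endAlgebra k C M ↔ ∀ (f : DualAlgebra k C) (m : M), φ (f • m) = f • φ m := by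
  constructor
  · intro hφ f m
    have hm : coact (φ m) = φ.rTensor C (coact (C := C) m) := DFunLike.congr_fun hφ m
    change _ = TensorProduct.rid k M (f.ofConv.lTensor M (coact (φ m)))
    rw [hm, rid_lTensor_rTensor]
    rfl
  · intro h
    refine LinearMap.ext fun m => tensor_ext fun f => ?_
    rw [LinearMap.comp_apply, LinearMap.comp_apply, rid_lTensor_rTensor]
    exact (h (WithConv.toConv f) m).symm

theorem toModuleEnd_op_mem_endAlgebra (g : DualAlgebra k C) :
    Module.toModuleEnd k C (op g) ∈ endAlgebra k C C :=
  mem_endAlgebra_iff.2 fun f c => (smul_comm f (op g) c).symm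

end RightComodule

/-! ### Primeness of the dual algebra and coprimeness of the coalgebra -/

open DualAlgebra

theorem IsPrimeAlgebra.rightComodule_isCoprime (h : IsPrimeAlgebra (DualAlgebra k C)) :
    RightComodule.IsCoprime k C C := by
  refine isCoprimeModule_of_forall_eq_zero fun K hK f hf => ?_
  obtain ⟨g, hg0, hg⟩ := exists_ne_zero_forall_mem_eq_zero (K := K.restrictScalars k)
    fun e => hK ((Submodule.restrictScalars_eq_top_iff k _ _).1 e)
  refine ((isPrimeAlgebra_iff.1 h).2 g f fun r => ?_).resolve_left hg0
  refine WithConv.ext (LinearMap.ext fun c => ?_)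
  rw [← apply_smul, ← apply_smul]
  exact hg _ (K.smul_mem r (hf c))

theorem IsPrimeAlgebra.leftComodule_isCoprime (h : IsPrimeAlgebra (DualAlgebra k C)) :
    LeftComodule.IsCoprime k C C := by
  refine isCoprimeModule_of_forall_eq_zero fun K hK f hf => ?_
  obtain ⟨g, hg0, hg⟩ := exists_ne_zero_forall_mem_eq_zero (K := K.restrictScalars k)
    fun e => hK ((Submodule.restrictScalars_eq_top_iff k _ _).1 e)
  refine (unop_eq_zero_iff f).1 <|
    ((isPrimeAlgebra_iff.1 h).2 f.unop g fun r => ?_).resolve_right hg0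
  refine WithConv.ext (LinearMap.ext fun c => ?_)
  rw [mul_assoc, ← apply_op_smul, ← apply_op_smul]
  exact hg _ (K.smul_mem (op r) (hf c))

theorem IsPrimeAlgebra.isEndoCoprime (h : IsPrimeAlgebra (DualAlgebra k C)) :
    RightComodule.IsEndoCoprime k C C := by
  intro K _ hinv hK φ hφ hφK
  obtain ⟨b, hb0, hb⟩ := exists_ne_zero_forall_mem_eq_zero hK
  have hg := op_toConv_counit_comp_smul (RightComodule.mem_endAlgebra_iff.1 hφ)
  set g : DualAlgebra k C := WithConv.toConv (Coalgebra.counit ∘ₗ φ)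
  have hg0 : g = 0 := by
    refine ((isPrimeAlgebra_iff.1 h).2 g b fun r => ?_).resolve_right hb0
    refine WithConv.ext (LinearMap.ext fun c => ?_)
    rw [mul_assoc, ← apply_op_smul, ← apply_op_smul, hg]
    exact hb _ (hinv _ (RightComodule.toModuleEnd_op_mem_endAlgebra r) _ (hφK c))
  refine LinearMap.ext fun c => ?_
  rw [← hg, hg0]
  exact zero_smul (DualAlgebra k C)ᵐᵒᵖ c

theorem RightComodule.IsEndoCoprime.isPrimeAlgebra [Nontrivial C]
    (h : RightComodule.IsEndoCoprime k C C) : IsPrimeAlgebra (DualAlgebra k C) := by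
  refine isPrimeAlgebra_iff.2 ⟨Module.nontrivial _ C, fun a b hab => ?_⟩
  refine or_iff_not_imp_right.2 fun hb0 => ?_
  -- The orthogonal complement of the two-sided ideal generated by `b`.
  let K : Submodule k C :=
    { carrier := {c | ∀ r s : DualAlgebra k C, (r * b * s).ofConv c = 0}
      add_mem' := fun hx hy r s => by rw [map_add, hx, hy, add_zero]
      zero_mem' := fun r s => map_zero _
      smul_mem' := fun t c hc r s => by rw [map_smul, hc, smul_zero] }
  have hsub : RightComodule.IsSubcomodule k C C K :=
    RightComodule.isSubcomodule_of_act_mem fun f c hc r s => by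
      rw [apply_smul, mul_assoc]
      exact hc r (s * f)
  have hinv : ∀ φ ∈ RightComodule.endAlgebra k C C, ∀ c ∈ K, φ c ∈ K := by
    intro φ hφ c hc r s
    rw [← op_toConv_counit_comp_smul (RightComodule.mem_endAlgebra_iff.1 hφ), apply_op_smul,
      ← mul_assoc, ← mul_assoc]
    exact hc _ s
  have hK : K ≠ ⊤ := fun e => hb0 <| WithConv.ext <| LinearMap.ext fun c => by
    have hc : c ∈ K := e ▸ Submodule.mem_top
    simpa using hc 1 1
  have ha := h K hsub hinv hK _ (RightComodule.toModuleEnd_op_mem_endAlgebra a) fun c r s => by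
    change (r * b * s).ofConv (op a • c) = 0
    rw [apply_op_smul, ← mul_assoc, ← mul_assoc, hab, zero_mul]
    rfl
  exact eq_zero_of_op_smul fun c => DFunLike.congr_fun ha c

theorem IsPrimeAlgebra.isFullyCoprime (h : IsPrimeAlgebra (DualAlgebra k C)) :
    RightComodule.IsFullyCoprime k C C := by
  intro K _ hK
  let F : ((C ⧸ K →ₗ[DualAlgebra k C] C) →₀ C ⧸ K) →ₗ[DualAlgebra k C] C :=
    Finsupp.lsum ℕ fun φ => φ
  refine ⟨_, F, LinearMap.range_eq_top.1 ?_⟩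
  by_contra hF
  obtain ⟨g, hg0, hg⟩ := exists_ne_zero_forall_mem_eq_zero (K := K.restrictScalars k)
    fun e => hK ((Submodule.restrictScalars_eq_top_iff k _ _).1 e)
  obtain ⟨b, hb0, hb⟩ := exists_ne_zero_forall_mem_eq_zero (K := F.range.restrictScalars k)
    fun e => hF ((Submodule.restrictScalars_eq_top_iff k _ _).1 e)
  refine ((isPrimeAlgebra_iff.1 h).2 g b fun r => ?_).elim hg0 hb0
  -- Since `g * r` vanishes on `K`, the action `↼ (g * r)` factors through `C ⧸ K`.
  let ψ : C →ₗ[DualAlgebra k C] C :=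
    { toFun := fun c => op (g * r) • c
      map_add' := smul_add _
      map_smul' := fun f c => (smul_comm f _ c).symm }
  have hψ : K ≤ ψ.ker := fun c hc => ext_of_apply fun s => by
    change s.ofConv (op (g * r) • c) = _
    rw [apply_op_smul, mul_assoc, ← apply_smul, map_zero]
    exact hg _ (K.smul_mem _ hc)
  refine WithConv.ext (LinearMap.ext fun c => ?_)
  rw [← apply_op_smul]
  exact hb _ ⟨Finsupp.single (K.liftQ ψ hψ) (K.mkQ c), by simp [F, ψ]⟩

end Pairing

theorem mainTheorem3 (k : Type u) (C : Type v) [Field k] [AddCommGroup C] [Module k C]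
    [Coalgebra k C] [Nontrivial C] :
    List.TFAE [
      RightComodule.IsCoprime k C C,
      LeftComodule.IsCoprime k C C,
      RightComodule.IsEndoCoprime k C C,
      RightComodule.IsFullyCoprime k C C,
      ∀ I : Ideal (DualAlgebra k C),
        I • (⊤ : Submodule (DualAlgebra k C) C) = ⊥ ∨ I • (⊤ : Submodule (DualAlgebra k C) C) = ⊤,
      IsPrimeAlgebra (DualAlgebra k C)] := by
  tfae_have 1 ↔ 5 := isCoprimeModule_iff_smul_top
  tfae_have 1 → 6 := IsCoprimeModule.isPrimeAlgebra
  tfae_have 6 → 1 := IsPrimeAlgebra.rightComodule_isCoprime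
  tfae_have 2 → 6 := fun h => (IsCoprimeModule.isPrimeAlgebra h).of_mulOpposite
  tfae_have 6 → 2 := IsPrimeAlgebra.leftComodule_isCoprime
  tfae_have 3 → 6 := RightComodule.IsEndoCoprime.isPrimeAlgebra
  tfae_have 6 → 3 := IsPrimeAlgebra.isEndoCoprime
  tfae_have 4 → 1 := IsFullyCoprimeModule.isCoprimeModule
  tfae_have 6 → 4 := IsPrimeAlgebra.isFullyCoprime
  tfae_finish
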